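/- Let $\mathbb{D}=\{z\in\mathbb{C}:|z|<1\}$. Let $h$ be a lemniscate starlike function, that is, $h$ is analytic in $\mathbb{D}$ with $h(0)=0$, $h'(0)=1$, and $zh'(z)/h(z)\prec\sqrt{1+z}$ (principal branch), where $p\prec\psi$ means that $p=\psi\circ\omega$ on $\mathbb{D}$ for some analytic $\omega:\mathbb{D}\to\mathbb{D}$ with $\omega(0)=0$, and the value of $zh'(z)/h(z)$ at $z=0$ is its limit $1$. Let $\varphi:\mathbb{D}\to\mathbb{D}$ be analytic, and let $g$ be analytic in $\mathbb{D}$ with $g'(z)=\varphi(z)h'(z)$ for all $z\in\mathbb{D}$. Then the equation $$1-6r+12r^2-11r^3+4r^4=0$$ has exactly one root $r_0$ in $(0,1)$, it satisfies $0.3119<r_0<0.3120$, and the harmonic mapping $f=h+\overline{g}$ is univalent and close-to-convex in $|z|<r_0$. Here $f$ is called close-to-convex in $|z|<r_0$ if there it is harmonic, univalent and sense-preserving (its Jacobian is positive), and it maps this disk onto a close-to-convex domain, i.e. a domain whose complement is a union of closed half-lines such that the corresponding open half-lines are pairwise disjoint. -/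

import Mathlib

open Metric Set
open scoped ComplexConjugate

noncomputable section

/-- The class of analytic functions `h` on the open unit disk with `h 0 = 0` and `h' 0 = 1`. -/
def ClassA : Set (ℂ → ℂ) :=
  {h | DifferentiableOn ℂ h (ball 0 1) ∧ h 0 = 0 ∧ deriv h 0 = 1}

/-- The analytic functions from the open unit disk into the open unit disk. -/
def ClassBs : Set (ℂ → ℂ) :=
  {φ | DifferentiableOn ℂ φ (ball 0 1) ∧ MapsTo φ (ball 0 1) (ball 0 1)}

/-- Subordination `p ≺ ψ` on the open unit disk: `p = ψ ∘ ω` for an analytic self-map `ω` of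
the disk that fixes the origin. -/
def Subordinate (p ψ : ℂ → ℂ) : Prop :=
  ∃ ω ∈ ClassBs, ω 0 = 0 ∧ ∀ z ∈ ball (0 : ℂ) 1, p z = ψ (ω z)

/-- The function `z h'(z) / h(z)`, with its removable singularity at the origin filled in
(for `h` with `h 0 = 0` and `h' 0 = 1` its limit at the origin is `1`). -/
def starlikeQuotient (h : ℂ → ℂ) : ℂ → ℂ :=
  Function.update (fun z => z * deriv h z / h z) 0 1

/-- The Ma-Minda class of starlike functions attached to `ψ`. -/
def ClassSStar (ψ : ℂ → ℂ) : Set (ℂ → ℂ) :=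
  {h | h ∈ ClassA ∧ Subordinate (starlikeQuotient h) ψ}

/-- The lemniscate starlike functions: `ψ z = √(1 + z)`, with the principal square root. -/
def ClassSLStar : Set (ℂ → ℂ) :=
  ClassSStar fun z => (1 + z) ^ (1 / 2 : ℂ)

/-- The closed half-line from `p` in direction `d` (for `d ≠ 0`). -/
def closedHalfLine (p d : ℂ) : Set ℂ := {w | ∃ t : ℝ, 0 ≤ t ∧ w = p + t * d}

/-- The corresponding open half-line: the initial point `p` is removed. -/
def openHalfLine (p d : ℂ) : Set ℂ := {w | ∃ t : ℝ, 0 < t ∧ w = p + t * d}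

/-- A domain is close-to-convex if its complement is a union of (closed) half-lines such that the
corresponding open half-lines are pairwise disjoint. A half-line is given by its initial point
and a nonzero direction. -/
def IsCloseToConvexDomain (Ω : Set ℂ) : Prop :=
  IsOpen Ω ∧ IsConnected Ω ∧
    ∃ L : Set (ℂ × ℂ), (∀ l ∈ L, l.2 ≠ 0) ∧
      Ωᶜ = (⋃ l ∈ L, closedHalfLine l.1 l.2) ∧
      L.PairwiseDisjoint (fun l => openHalfLine l.1 l.2)

/-- `f` is univalent in `U`. -/
def IsUnivalentOn (f : ℂ → ℂ) (U : Set ℂ) : Prop := InjOn f U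

/-- `f` is sense-preserving in `U`: its (real) Jacobian is positive there. -/
def IsSensePreservingOn (f : ℂ → ℂ) (U : Set ℂ) : Prop :=
  ∀ z ∈ U, DifferentiableAt ℝ f z ∧ 0 < (fderiv ℝ f z).det

/-- `f` is a close-to-convex harmonic mapping in `U`: harmonic, univalent, sense-preserving, and
it maps `U` onto a close-to-convex domain. -/
def IsCloseToConvexOn (f : ℂ → ℂ) (U : Set ℂ) : Prop :=
  InnerProductSpace.HarmonicOnNhd f U ∧ IsUnivalentOn f U ∧ IsSensePreservingOn f U ∧
    IsCloseToConvexDomain (f '' U)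

end

/-! In the coordinate w = h(z), the map f = h + conj g becomes w + E(w), with E the conjugate of g ∘
h⁻¹. Since g'/h' = φ, the holomorphic function g ∘ h⁻¹ has derivative φ ∘ h⁻¹, so on a convex image
of h the map E is a contraction with constant k = max |φ| < 1 over a compact disk. Hence f is
injective as soon as h is injective with convex image, and its Jacobian |h'|² (1 - |φ|²) is
positive.

Close-to-convexity of the image is a fact about any convex domain Ω and any contraction E on its
closure (`isCloseToConvexDomain_image_id_add`). With P the nearest-point projection onto the
closure, x + E(P x) is a homeomorphism of the plane. P is constant on each outward normal ray, so
such a ray is merely translated. These rays fill the complement of Ω, and so their translates fill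
the complement of the image.

It remains to see that h is injective with convex image on disks of radius up to 0.312, which
exceeds r₀. Schwarz–Pick gives |h''| ≤ 1.3 |h'| there (`norm_deriv_deriv_le_of_ne_zero`), and a
bound M on |h''/h'| with M ρ e^(2Mρ) < 1 suffices (`HasSmallPreSchwarzian.convex_image`). The
quartic enters only through r₀ < 0.312. -/

section

open scoped InnerProductSpace Topology NNReal


/-! ### Nearest-point projection and contractive perturbations of the identity -/

/-- Variational characterization of the point of `K` nearest to `x`. -/
def IsNearestPoint (K : Set ℂ) (x p : ℂ) : Prop :=
  p ∈ K ∧ ∀ y ∈ K, ⟪x - p, y - p⟫_ℝ ≤ 0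

theorem exists_isNearestPoint {K : Set ℂ} (hne : K.Nonempty) (hcl : IsClosed K)
    (hK : Convex ℝ K) (x : ℂ) : ∃ p, IsNearestPoint K x p := by
  obtain ⟨p, hp, h⟩ := exists_norm_eq_iInf_of_complete_convex hne hcl.isComplete hK x
  exact ⟨p, hp, (norm_eq_iInf_iff_real_inner_le_zero hK hp).1 h⟩

/-- Adding the two variational inequalities gives ‖p - q‖² ≤ ⟪x - y, p - q⟫, and Cauchy–Schwarz
finishes. This nonexpansiveness keeps the Lipschitz constant of a contraction composed with the
projection below 1. -/
theorem IsNearestPoint.norm_sub_le {K : Set ℂ} {x y p q : ℂ} (hp : IsNearestPoint K x p)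
    (hq : IsNearestPoint K y q) : ‖p - q‖ ≤ ‖x - y‖ := by
  have h1 := hp.2 q hq.1
  have h2 := hq.2 p hp.1
  have h3 : ‖p - q‖ ^ 2 ≤ ⟪x - y, p - q⟫_ℝ := by
    rw [← real_inner_self_eq_norm_sq]
    have e1 : ⟪x - p, q - p⟫_ℝ = -⟪x - p, p - q⟫_ℝ := by
      rw [← inner_neg_right, neg_sub]
    rw [e1] at h1
    have e2 : ⟪x - y, p - q⟫_ℝ = ⟪x - p, p - q⟫_ℝ + ⟪p - q, p - q⟫_ℝ - ⟪y - q, p - q⟫_ℝ := by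
      rw [← inner_add_left, ← inner_sub_left]
      congr 1
      ring
    linarith
  have h4 := real_inner_le_norm (x - y) (p - q)
  by_contra! hc
  nlinarith [norm_nonneg (x - y), norm_nonneg (p - q)]

theorem IsNearestPoint.eq {K : Set ℂ} {x p q : ℂ} (hp : IsNearestPoint K x p)
    (hq : IsNearestPoint K x q) : p = q := by
  have := hp.norm_sub_le hq
  rw [sub_self, norm_zero] at this
  exact sub_eq_zero.1 (norm_le_zero_iff.1 this)

theorem isNearestPoint_self {K : Set ℂ} {x : ℂ} (hx : x ∈ K) : IsNearestPoint K x x :=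
  ⟨hx, fun y _ => by simp⟩

theorem isNearestPoint_add_normal {K : Set ℂ} {w n : ℂ} (hw : w ∈ K)
    (hn : ∀ y ∈ K, ⟪n, y - w⟫_ℝ ≤ 0) {t : ℝ} (ht : 0 ≤ t) :
    IsNearestPoint K (w + t * n) w := by
  refine ⟨hw, fun y hy => ?_⟩
  have : w + t * n - w = t • n := by simp
  rw [this, inner_smul_left]
  exact mul_nonpos_of_nonneg_of_nonpos ht (hn y hy)

/-- A point outside an open convex set has a supporting unit normal. -/
theorem exists_unit_normal {Ω : Set ℂ} (ho : IsOpen Ω) (hc : Convex ℝ Ω) (hne : Ω.Nonempty)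
    {x : ℂ} (hx : x ∉ Ω) : ∃ n : ℂ, ‖n‖ = 1 ∧ ∀ y ∈ closure Ω, ⟪n, y - x⟫_ℝ ≤ 0 := by
  obtain ⟨f, hf⟩ := geometric_hahn_banach_open_point hc ho hx
  set v := (InnerProductSpace.toDual ℝ ℂ).symm f with hv
  have hvf : ∀ y, ⟪v, y⟫_ℝ = f y := fun y => by
    rw [hv, InnerProductSpace.toDual_symm_apply]
  have hv0 : v ≠ 0 := by
    rintro h0
    obtain ⟨a, ha⟩ := hne
    have := hf a ha
    rw [← hvf, ← hvf, h0] at this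
    simp at this
  have hcl : ∀ y ∈ closure Ω, ⟪v, y - x⟫_ℝ ≤ 0 := by
    have hcl : IsClosed {y : ℂ | ⟪v, y - x⟫_ℝ ≤ 0} :=
      isClosed_le (by fun_prop) continuous_const
    refine fun y hy => closure_minimal (fun a ha => ?_) hcl hy
    have := hf a ha
    rw [mem_ofPred_eq, inner_sub_right, hvf, hvf]
    linarith
  refine ⟨‖v‖⁻¹ • v, ?_, fun y hy => ?_⟩
  · rw [norm_smul, norm_inv, norm_norm, inv_mul_cancel₀ (norm_ne_zero_iff.2 hv0)]
  · rw [inner_smul_left]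
    exact mul_nonpos_of_nonneg_of_nonpos (inv_nonneg.2 (norm_nonneg v)) (hcl y hy)

/-- Solving x + E x = y amounts to finding a fixed point of the contraction x ↦ y - E x. -/
theorem bijective_id_add_of_lipschitz {E : ℂ → ℂ} {k : ℝ≥0} (hk : k < 1)
    (hE : LipschitzWith k E) : Function.Bijective fun x => x + E x := by
  constructor
  · intro x y hxy
    have h1 := hE.dist_le_mul x y
    have h2 : dist x y = dist (E x) (E y) := by
      rw [dist_eq_norm, dist_eq_norm, ← norm_neg (E x - E y)]
      congr 1
      linear_combination hxy
    have hk' : (k : ℝ) < 1 := hk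
    by_contra hne
    have := dist_pos.2 hne
    nlinarith
  · intro y
    have hcon : ContractingWith k fun x => y - E x :=
      ⟨hk, LipschitzWith.of_dist_le_mul fun a b => by
        rw [dist_sub_left]; exact hE.dist_le_mul a b⟩
    refine ⟨hcon.fixedPoint _, ?_⟩
    have := hcon.fixedPoint_isFixedPt
    simp only [Function.IsFixedPt] at this
    linear_combination -this

theorem isClosedMap_id_add_of_lipschitz {E : ℂ → ℂ} {k : ℝ≥0} (hk : k < 1)
    (hE : LipschitzWith k E) : IsClosedMap fun x => x + E x := by
  have hk' : (k : ℝ) < 1 := hk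
  have hpos : 0 < 1 - (k : ℝ) := by linarith
  have hanti : AntilipschitzWith (Real.toNNReal (1 - k)⁻¹) fun x => x + E x := by
    refine AntilipschitzWith.of_le_mul_dist fun x y => ?_
    rw [Real.coe_toNNReal _ (inv_nonneg.2 hpos.le), inv_mul_eq_div, le_div_iff₀ hpos]
    have h1 := hE.dist_le_mul x y
    have h2 : dist x y ≤ dist (x + E x) (y + E y) + dist (E x) (E y) := by
      simp only [dist_eq_norm]
      calc ‖x - y‖ = ‖(x + E x - (y + E y)) - (E x - E y)‖ := by congr 1; ring
        _ ≤ _ := norm_sub_le _ _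
    nlinarith
  have huc : UniformContinuous fun x => x + E x :=
    uniformContinuous_id.add hE.uniformContinuous
  exact (hanti.isClosedEmbedding huc).isClosedMap

/-- A contractive perturbation of the identity maps a convex domain onto a close-to-convex
domain: composed with the nearest-point projection it extends to a homeomorphism of the plane that
translates every normal ray. -/
theorem isCloseToConvexDomain_image_id_add {Ω : Set ℂ} (ho : IsOpen Ω) (hc : Convex ℝ Ω)
    (hne : Ω.Nonempty) {H : ℂ → ℂ} {k : ℝ≥0} (hk : k < 1)
    (hH : LipschitzOnWith k H (closure Ω)) :
    IsCloseToConvexDomain ((fun w => w + H w) '' Ω) := by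
  choose P hP using exists_isNearestPoint hne.closure isClosed_closure hc.closure
  have hPeq : ∀ x ∈ closure Ω, P x = x := fun x hx => (hP x).eq (isNearestPoint_self hx)
  have hE : LipschitzWith k (fun x => H (P x)) := by
    refine LipschitzWith.of_dist_le_mul fun x y => ?_
    refine (hH.dist_le_mul _ (hP x).1 _ (hP y).1).trans ?_
    gcongr
    rw [dist_eq_norm, dist_eq_norm]
    exact (hP x).norm_sub_le (hP y)
  set T : ℂ → ℂ := fun x => x + H (P x) with hT
  have hbij : Function.Bijective T := bijective_id_add_of_lipschitz hk hE
  have himg : (fun w => w + H w) '' Ω = T '' Ω := by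
    refine image_congr fun w hw => ?_
    simp only [hT, hPeq w (subset_closure hw)]
  have hray : ∀ w n : ℂ, w ∈ closure Ω → (∀ y ∈ closure Ω, ⟪n, y - w⟫_ℝ ≤ 0) →
      ∀ t : ℝ, 0 ≤ t → P (w + t * n) = w := fun w n hw hn t ht =>
    (hP _).eq (isNearestPoint_add_normal hw hn ht)
  have hTray : ∀ w n : ℂ, w ∈ closure Ω → (∀ y ∈ closure Ω, ⟪n, y - w⟫_ℝ ≤ 0) →
      ∀ t : ℝ, 0 ≤ t → T (w + t * n) = T w + t * n := fun w n hw hn t ht => by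
    simp only [hT, hray w n hw hn t ht, hPeq w hw]
    ring
  rw [himg]
  -- The half-lines are the translated normal rays. Directions are normalized to length 1 so that
  -- one ray is not listed under several multiples of its direction.
  refine ⟨?_, ?_, {l | ∃ w ∈ closure Ω, l.1 = T w ∧ ‖l.2‖ = 1 ∧
    ∀ y ∈ closure Ω, ⟪l.2, y - w⟫_ℝ ≤ 0}, ?_, ?_, ?_⟩
  · rw [← isClosed_compl_iff, ← image_compl_eq hbij]
    exact isClosedMap_id_add_of_lipschitz hk hE _ ho.isClosed_compl
  · exact (hc.isConnected hne).image _ (continuous_id.add hE.continuous).continuousOn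
  · rintro l ⟨w, -, -, h1, -⟩ h0
    simp [h0] at h1
  · rw [← image_compl_eq hbij]
    ext q
    simp only [mem_iUnion, exists_prop]
    constructor
    · rintro ⟨x, hx, rfl⟩
      by_cases hxc : x ∈ closure Ω
      · obtain ⟨n, hn1, hn⟩ := exists_unit_normal ho hc hne hx
        exact ⟨(T x, n), ⟨x, hxc, rfl, hn1, hn⟩, 0, le_rfl, by simp⟩
      · have hpos : 0 < ‖x - P x‖ := by
          rw [norm_pos_iff, sub_ne_zero]
          intro h
          exact hxc (h ▸ (hP x).1)
        have hn : ∀ y ∈ closure Ω, ⟪‖x - P x‖⁻¹ • (x - P x), y - P x⟫_ℝ ≤ 0 := fun y hy => by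
          rw [inner_smul_left]
          exact mul_nonpos_of_nonneg_of_nonpos (inv_nonneg.2 hpos.le) ((hP x).2 y hy)
        refine ⟨(T (P x), ‖x - P x‖⁻¹ • (x - P x)), ⟨P x, (hP x).1, rfl, ?_, hn⟩,
          ‖x - P x‖, hpos.le, ?_⟩
        · rw [norm_smul, norm_inv, norm_norm, inv_mul_cancel₀ hpos.ne']
        · have := hTray (P x) _ (hP x).1 hn ‖x - P x‖ hpos.le
          rw [← this]
          congr 1
          rw [← Complex.real_smul, smul_inv_smul₀ hpos.ne']
          ring
    · rintro ⟨⟨a, n⟩, ⟨w, hw, rfl, hn1, hn⟩, t, ht, rfl⟩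
      -- If w + t n lay in the open set Ω, a slightly longer step along n would stay in the closure
      -- and violate the supporting inequality at w.
      refine ⟨w + t * n, fun hmem => ?_, hTray w n hw hn t ht⟩
      obtain ⟨ε, hε, hball⟩ := Metric.isOpen_iff.1 ho _ hmem
      have hmem' : w + (t + ε / 2 : ℝ) * n ∈ closure Ω := by
        refine subset_closure (hball ?_)
        rw [mem_ball, dist_eq_norm]
        have : w + ((t + ε / 2 : ℝ) : ℂ) * n - (w + t * n) = (ε / 2 : ℝ) • n := by
          rw [Complex.real_smul]; push_cast; ring
        rw [this, norm_smul]
        dsimp only at hn1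
        rw [hn1, Real.norm_of_nonneg (by positivity)]
        linarith
      have h3 := hn _ hmem'
      have h4 : w + ((t + ε / 2 : ℝ) : ℂ) * n - w = (t + ε / 2 : ℝ) • n := by
        rw [Complex.real_smul]; ring
      dsimp only at hn1 h3
      rw [h4, inner_smul_right, real_inner_self_eq_norm_sq, hn1] at h3
      linarith
  -- A common point pulls back through the injective T to one point on two normal rays. Its
  -- projection determines w, its distance to w determines t, and then n is determined.
  · rintro ⟨a, n⟩ ⟨w, hw, ha, hn1, hn⟩ ⟨a', n'⟩ ⟨w', hw', ha', hn1', hn'⟩ hne'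
    dsimp only at ha ha' hn1 hn1' hn hn'
    subst ha ha'
    rw [Function.onFun, Set.disjoint_left]
    rintro q ⟨t, ht, rfl⟩ ⟨t', ht', heq⟩
    dsimp only at heq
    rw [← hTray w n hw hn t ht.le, ← hTray w' n' hw' hn' t' ht'.le] at heq
    have hpt := hbij.1 heq
    have hww : w = w' := by
      rw [← hray w n hw hn t ht.le, hpt, hray w' n' hw' hn' t' ht'.le]
    subst hww
    have hsm : t • n = t' • n' := by
      simpa [Complex.real_smul] using hpt
    have htt : t = t' := by
      have := congrArg norm hsm
      rwa [norm_smul, norm_smul, hn1, hn1', Real.norm_of_nonneg ht.le,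
        Real.norm_of_nonneg ht'.le, mul_one, mul_one] at this
    subst htt
    exact hne' (by rw [smul_right_injective ℂ ht.ne' hsm])


/-! ### Covering and growth estimates -/

/-- If `ν < ‖h'‖` on a closed disk of radius `ρ`, its image contains the closed disk of
radius `ν * ρ` about the image of the centre. -/
theorem exists_mem_closedBall_eq_of_lt_norm_deriv {h : ℂ → ℂ} {c w : ℂ} {ρ ν : ℝ} (hρ : 0 ≤ ρ)
    (hν : 0 ≤ ν) (hd : ∀ z ∈ closedBall c ρ, DifferentiableAt ℂ h z)
    (hder : ∀ z ∈ closedBall c ρ, ν < ‖deriv h z‖) (hw : ‖h c - w‖ ≤ ν * ρ) :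
    ∃ z ∈ closedBall c ρ, h z = w := by
  by_contra! hne
  -- Minimize the penalized distance ‖h z - w‖ + ν ‖z - c‖. Its value at c is at most ν ρ, so a
  -- minimizer with h z ≠ w is interior.
  have hcont : ContinuousOn (fun z => ‖h z - w‖ + ν * ‖z - c‖) (closedBall c ρ) := by
    have : ContinuousOn h (closedBall c ρ) := fun z hz => (hd z hz).continuousAt.continuousWithinAt
    fun_prop
  obtain ⟨z, hz, hmin⟩ :=
    (isCompact_closedBall c ρ).exists_isMinOn ⟨c, mem_closedBall_self hρ⟩ hcont
  rw [isMinOn_iff] at hmin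
  have hA : 0 < ‖h z - w‖ := norm_pos_iff.2 (sub_ne_zero.2 (hne z hz))
  have hzint : z ∈ ball c ρ := by
    rw [mem_ball, dist_eq_norm]
    have := hmin c (mem_closedBall_self hρ)
    rw [sub_self, norm_zero, mul_zero, add_zero] at this
    exact lt_of_mul_lt_mul_left (by linarith) hν
  have hD : 0 < ‖deriv h z‖ := hν.trans_lt (hder z hz)
  have hD0 : deriv h z ≠ 0 := norm_pos_iff.1 hD
  set A := ‖h z - w‖
  set q := ν / ‖deriv h z‖
  have hq : q < 1 := (div_lt_one hD).2 (hder z hz)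
  -- Newton direction: moving along u decreases the first term at rate A and increases the penalty
  -- at rate at most q A < A, contradicting minimality.
  set u := (w - h z) / deriv h z with hu
  have hline : HasDerivAt (fun s : ℝ => h (z + s * u)) (w - h z) 0 := by
    have h1 : HasDerivAt (fun s : ℝ => z + (s : ℂ) * u) u 0 := by
      simpa using ((Complex.ofRealCLM.hasDerivAt (x := 0)).mul_const u).const_add z
    have h2 : HasDerivAt h (deriv h z) (z + ((0 : ℝ) : ℂ) * u) := by
      simpa using (hd z hz).hasDerivAt
    have := h2.comp (0 : ℝ) h1
    rwa [hu, mul_div_cancel₀ _ hD0] at this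
  have hε : 0 < A * (1 - q) / 2 := by
    have : 0 < 1 - q := by linarith
    positivity
  have hlo := (hasDerivAt_iff_isLittleO.1 hline).def hε
  have hcb : ∀ᶠ s : ℝ in 𝓝 0, z + s * u ∈ ball c ρ := by
    have hc : ContinuousAt (fun s : ℝ => z + s * u) 0 := by fun_prop
    exact hc (by simpa using isOpen_ball.mem_nhds hzint)
  have hlt : ∀ᶠ s : ℝ in 𝓝 0, s < 1 := eventually_lt_nhds one_pos
  obtain ⟨s, ⟨⟨h1, h2⟩, h3⟩, hs⟩ :=
    ((((hlo.and hcb).and hlt).filter_mono nhdsWithin_le_nhds).and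
      (self_mem_nhdsWithin (s := Ioi (0 : ℝ)))).exists
  have hmin' := hmin _ (ball_subset_closedBall h2)
  simp only [Complex.ofReal_zero, zero_mul, add_zero, sub_zero, Complex.real_smul,
    Real.norm_of_nonneg hs.le] at h1
  have h4 : ‖h (z + s * u) - w‖ ≤ A * (1 - q) / 2 * s + (1 - s) * A := by
    calc ‖h (z + s * u) - w‖
        = ‖(h (z + s * u) - h z - s * (w - h z)) + ((1 - s : ℝ) : ℂ) * (h z - w)‖ := by
          congr 1; push_cast; ring
      _ ≤ _ := by
          refine (norm_add_le _ _).trans (add_le_add h1 ?_)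
          rw [norm_mul, Complex.norm_real, Real.norm_of_nonneg (by linarith)]
  have h5 : ν * ‖z + s * u - c‖ ≤ ν * ‖z - c‖ + s * (q * A) := by
    have : ‖z + s * u - c‖ ≤ ‖z - c‖ + s * (A / ‖deriv h z‖) := by
      calc ‖z + s * u - c‖ = ‖(z - c) + s * u‖ := by congr 1; ring
        _ ≤ ‖z - c‖ + ‖(s : ℂ) * u‖ := norm_add_le _ _
        _ = _ := by
          rw [norm_mul, Complex.norm_real, Real.norm_of_nonneg hs.le, hu, norm_div,
            norm_sub_rev w]
    calc _ ≤ ν * (‖z - c‖ + s * (A / ‖deriv h z‖)) := by gcongr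
      _ = _ := by simp only [q]; ring
  have : 0 < s * (A * (1 - q)) := by
    have : 0 < 1 - q := by linarith
    positivity
  nlinarith

theorem hasDerivAt_comp_line {F : ℂ → ℂ} {a v : ℂ} {t : ℝ}
    (hF : DifferentiableAt ℂ F (a + t * v)) :
    HasDerivAt (fun s : ℝ => F (a + s * v)) (deriv F (a + t * v) * v) t := by
  have h1 : HasDerivAt (fun s : ℝ => a + (s : ℂ) * v) v t := by
    simpa using ((Complex.ofRealCLM.hasDerivAt (x := t)).mul_const v).const_add a
  exact hF.hasDerivAt.comp t h1

theorem add_mul_sub_mem {s : Set ℂ} (hs : Convex ℝ s) {a b : ℂ} (ha : a ∈ s) (hb : b ∈ s) {t : ℝ}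
    (ht : t ∈ Icc (0 : ℝ) 1) : a + t * (b - a) ∈ s := by
  have := hs.add_smul_sub_mem ha hb ht
  rwa [Complex.real_smul] at this

/-- Grönwall's inequality along the segment from a to b. Applied to `deriv h` in both directions, it
bounds |h'| above and below. -/
theorem norm_le_mul_exp_of_norm_deriv_le {F : ℂ → ℂ} {s : Set ℂ} {M : ℝ} (hs : Convex ℝ s)
    (hd : ∀ z ∈ s, DifferentiableAt ℂ F z) (hM : ∀ z ∈ s, ‖deriv F z‖ ≤ M * ‖F z‖)
    {a b : ℂ} (ha : a ∈ s) (hb : b ∈ s) : ‖F b‖ ≤ ‖F a‖ * Real.exp (M * ‖b - a‖) := by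
  have hder : ∀ t ∈ Icc (0 : ℝ) 1, HasDerivAt (fun t : ℝ => F (a + t * (b - a)))
      (deriv F (a + t * (b - a)) * (b - a)) t := fun t ht =>
    hasDerivAt_comp_line (hd _ (add_mul_sub_mem hs ha hb ht))
  have := norm_le_gronwallBound_of_norm_deriv_right_le (δ := ‖F a‖) (K := M * ‖b - a‖) (ε := 0)
    (fun t ht => (hder t ht).continuousAt.continuousWithinAt)
    (fun t ht => (hder t (Ico_subset_Icc_self ht)).hasDerivWithinAt) (by simp)
    (fun t ht => by
      have := hM _ (add_mul_sub_mem hs ha hb (Ico_subset_Icc_self ht))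
      rw [norm_mul, add_zero]
      nlinarith [norm_nonneg (b - a)]) 1 (by simp)
  rw [gronwallBound_ε0] at this
  simpa using this

theorem norm_sub_sub_le_of_norm_deriv_sub_le {h : ℂ → ℂ} {s : Set ℂ} {L : ℝ} (hs : Convex ℝ s)
    (hd : ∀ z ∈ s, DifferentiableAt ℂ h z) {a b : ℂ} (ha : a ∈ s) (hb : b ∈ s)
    (hL : ∀ z ∈ s, ‖deriv h z - deriv h a‖ ≤ L * ‖z - a‖) :
    ‖h b - h a - deriv h a * (b - a)‖ ≤ L / 2 * ‖b - a‖ ^ 2 := by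
  have hder : ∀ t ∈ Icc (0 : ℝ) 1,
      HasDerivAt (fun t : ℝ => h (a + t * (b - a)) - h a - t * (deriv h a * (b - a)))
      (deriv h (a + t * (b - a)) * (b - a) - deriv h a * (b - a)) t := fun t ht => by
    have h1 := hasDerivAt_comp_line (hd _ (add_mul_sub_mem hs ha hb ht))
    have h2 := (Complex.ofRealCLM.hasDerivAt (x := t)).mul_const (deriv h a * (b - a))
    simpa using (h1.sub_const (h a)).fun_sub h2
  have := image_norm_le_of_norm_deriv_right_le_deriv_boundary (a := 0) (b := 1)
    (B := fun t => L * ‖b - a‖ ^ 2 * (t ^ 2 / 2)) (B' := fun t => L * ‖b - a‖ ^ 2 * t)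
    (fun t ht => (hder t ht).continuousAt.continuousWithinAt)
    (fun t ht => (hder t (Ico_subset_Icc_self ht)).hasDerivWithinAt) (by simp)
    (fun t => by
      have := ((hasDerivAt_pow 2 t).div_const 2).const_mul (L * ‖b - a‖ ^ 2)
      simpa using this)
    (fun t ht => by
      have h1 := hL _ (add_mul_sub_mem hs ha hb (Ico_subset_Icc_self ht))
      rw [add_sub_cancel_left, norm_mul, Complex.norm_real, Real.norm_of_nonneg ht.1] at h1
      rw [← sub_mul, norm_mul]
      nlinarith [norm_nonneg (b - a)]) (x := 1) (by simp)
  simp only [Complex.ofReal_one, one_mul, add_sub_cancel] at this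
  linarith

/-! ### Small pre-Schwarzian: injectivity and convex images -/

/-- A normalized function whose pre-Schwarzian is small on a disk, with a bound `M` for its
modulus. -/
structure HasSmallPreSchwarzian (h : ℂ → ℂ) (ρ M : ℝ) : Prop where
  differentiableOn : DifferentiableOn ℂ h (ball 0 ρ)
  deriv_zero : deriv h 0 = 1
  radius_pos : 0 < ρ
  norm_le : ∀ z ∈ ball (0 : ℂ) ρ, ‖deriv (deriv h) z‖ ≤ M * ‖deriv h z‖
  small : M * ρ * Real.exp (2 * (M * ρ)) < 1

namespace HasSmallPreSchwarzian

variable {h : ℂ → ℂ} {ρ M : ℝ}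

theorem nonneg (H : HasSmallPreSchwarzian h ρ M) : 0 ≤ M := by
  have := H.norm_le 0 (mem_ball_self H.radius_pos)
  rw [H.deriv_zero, norm_one, mul_one] at this
  exact (norm_nonneg _).trans this

theorem differentiableAt (H : HasSmallPreSchwarzian h ρ M) {z : ℂ} (hz : z ∈ ball (0 : ℂ) ρ) :
    DifferentiableAt ℂ h z := H.differentiableOn.differentiableAt (isOpen_ball.mem_nhds hz)

theorem differentiableAt_deriv (H : HasSmallPreSchwarzian h ρ M) {z : ℂ}
    (hz : z ∈ ball (0 : ℂ) ρ) : DifferentiableAt ℂ (deriv h) z :=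
  (H.differentiableOn.deriv isOpen_ball).differentiableAt (isOpen_ball.mem_nhds hz)

theorem norm_deriv_le (H : HasSmallPreSchwarzian h ρ M) {z : ℂ} (hz : z ∈ ball (0 : ℂ) ρ) :
    ‖deriv h z‖ ≤ Real.exp (M * ρ) := by
  have := norm_le_mul_exp_of_norm_deriv_le (convex_ball 0 ρ)
    (fun z hz => H.differentiableAt_deriv hz) H.norm_le (mem_ball_self H.radius_pos) hz
  rw [H.deriv_zero, norm_one, one_mul, sub_zero] at this
  refine this.trans (Real.exp_le_exp.2 ?_)
  have := mem_ball_zero_iff.1 hz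
  have := H.nonneg
  gcongr

theorem exp_neg_le_norm_deriv (H : HasSmallPreSchwarzian h ρ M) {z : ℂ}
    (hz : z ∈ ball (0 : ℂ) ρ) : Real.exp (-(M * ρ)) ≤ ‖deriv h z‖ := by
  have := norm_le_mul_exp_of_norm_deriv_le (convex_ball 0 ρ)
    (fun z hz => H.differentiableAt_deriv hz) H.norm_le hz (mem_ball_self H.radius_pos)
  rw [H.deriv_zero, norm_one, zero_sub, norm_neg] at this
  have h2 : Real.exp (M * ‖z‖) ≤ Real.exp (M * ρ) := by
    refine Real.exp_le_exp.2 ?_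
    have := mem_ball_zero_iff.1 hz
    have := H.nonneg
    gcongr
  rw [Real.exp_neg, inv_le_iff_one_le_mul₀ (Real.exp_pos _)]
  exact this.trans (by gcongr)

theorem norm_deriv_sub_le (H : HasSmallPreSchwarzian h ρ M) {x y : ℂ} (hx : x ∈ ball (0 : ℂ) ρ)
    (hy : y ∈ ball (0 : ℂ) ρ) :
    ‖deriv h y - deriv h x‖ ≤ M * Real.exp (M * ρ) * ‖y - x‖ := by
  refine (convex_ball (0 : ℂ) ρ).norm_image_sub_le_of_norm_deriv_le
    (fun z hz => H.differentiableAt_deriv hz) (fun z hz => (H.norm_le z hz).trans ?_) hx hy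
  have := H.nonneg
  gcongr
  exact H.norm_deriv_le hz

/-- This is the form in which `small` is used: the Lipschitz constant of h' times ρ stays below the
lower bound for |h'|. -/
theorem mul_exp_lt (H : HasSmallPreSchwarzian h ρ M) :
    M * Real.exp (M * ρ) * ρ < Real.exp (-(M * ρ)) := by
  have h1 := H.small
  rw [two_mul, Real.exp_add] at h1
  rw [Real.exp_neg, inv_eq_one_div, lt_div_iff₀ (Real.exp_pos _)]
  linarith

/-- Since h'(0) = 1, the derivative of h - id is bounded by M e^(Mρ) ρ < 1, so h is a contractive
perturbation of the identity. -/
theorem exists_antilipschitz (H : HasSmallPreSchwarzian h ρ M) :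
    ∃ c > 0, ∀ x ∈ ball (0 : ℂ) ρ, ∀ y ∈ ball (0 : ℂ) ρ, c * ‖x - y‖ ≤ ‖h x - h y‖ := by
  have hM := H.nonneg
  have hρ := H.radius_pos
  have hc : M * Real.exp (M * ρ) * ρ < 1 :=
    H.mul_exp_lt.trans_le (Real.exp_le_one_iff.2 (by nlinarith))
  refine ⟨1 - M * Real.exp (M * ρ) * ρ, by linarith, fun x hx y hy => ?_⟩
  have := (convex_ball (0 : ℂ) ρ).norm_image_sub_le_of_norm_deriv_le (f := fun z => h z - z)
    (C := M * Real.exp (M * ρ) * ρ)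
    (fun z hz => (H.differentiableAt hz).sub differentiableAt_id) (fun z hz => ?_) hy hx
  · have h2 : ‖x - y‖ ≤ ‖h x - h y‖ + ‖h x - x - (h y - y)‖ := by
      calc ‖x - y‖ = ‖(h x - h y) - (h x - x - (h y - y))‖ := by congr 1; ring
        _ ≤ _ := norm_sub_le _ _
    linarith
  · have h3 := H.norm_deriv_sub_le (mem_ball_self H.radius_pos) hz
    rw [H.deriv_zero, sub_zero] at h3
    have h4 : deriv (fun z => h z - z) z = deriv h z - 1 := by
      simpa using ((H.differentiableAt hz).hasDerivAt.fun_sub (hasDerivAt_id z)).deriv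
    rw [h4]
    refine h3.trans ?_
    have := (mem_ball_zero_iff.1 hz).le
    gcongr

theorem injOn (H : HasSmallPreSchwarzian h ρ M) : InjOn h (ball 0 ρ) := by
  obtain ⟨c, hc, hle⟩ := H.exists_antilipschitz
  intro x hx y hy hxy
  have := hle x hx y hy
  rw [hxy, sub_self, norm_zero] at this
  by_contra hne
  have := norm_pos_iff.2 (sub_ne_zero.2 hne)
  nlinarith

/-- The image of every concentric disk is convex. The segment between two image points stays
close, to second order, to the image of the chord, and the disk is uniformly convex. -/
theorem convex_image (H : HasSmallPreSchwarzian h ρ M) {r : ℝ} (hr : r ≤ ρ) :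
    Convex ℝ (h '' ball 0 r) := by
  rintro _ ⟨x, hx, rfl⟩ _ ⟨y, hy, rfl⟩ a b ha hb hab
  have hsub : ball (0 : ℂ) r ⊆ ball 0 ρ := ball_subset_ball hr
  obtain ⟨s, hs1, hsr⟩ := exists_between
    (max_lt (mem_ball_zero_iff.1 hx) (mem_ball_zero_iff.1 hy))
  obtain ⟨hxs, hys⟩ := max_lt_iff.1 hs1
  have hs : 0 < s := (norm_nonneg x).trans_lt hxs
  set c : ℂ := a • x + b • y with hc
  have hcmem : c ∈ ball (0 : ℂ) r := convex_ball 0 r hx hy ha hb hab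
  have hxc : x - c = b • (x - y) := by
    rw [hc, eq_sub_of_add_eq hab]; simp only [Complex.real_smul]; push_cast; ring
  have hyc : y - c = -(a • (x - y)) := by
    rw [hc, eq_sub_of_add_eq' hab]; simp only [Complex.real_smul]; push_cast; ring
  set L := M * Real.exp (M * ρ) with hL
  have hL0 : 0 ≤ L := mul_nonneg H.nonneg (Real.exp_pos _).le
  -- Uniform convexity of the disk: ‖c‖² ≤ s² - 2sδ ≤ (s - δ)², so the closed disk of radius δ about
  -- c still lies inside the disk of radius s.
  set δ := a * b * ‖x - y‖ ^ 2 / (2 * s) with hδ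
  have hδ0 : 0 ≤ δ := by positivity
  have hnc : ‖c‖ ≤ s - δ := by
    have h1 : ‖c‖ ^ 2 = a * ‖x‖ ^ 2 + b * ‖y‖ ^ 2 - a * b * ‖x - y‖ ^ 2 := by
      rw [hc, eq_sub_of_add_eq hab]
      simp only [Complex.sq_norm, Complex.normSq_apply, Complex.add_re, Complex.add_im,
        Complex.sub_re, Complex.sub_im, Complex.real_smul, Complex.re_ofReal_mul,
        Complex.im_ofReal_mul]
      ring
    have h2 : a * b * ‖x - y‖ ^ 2 = 2 * s * δ := by rw [hδ]; field_simp
    have h3 : a * ‖x‖ ^ 2 ≤ a * s ^ 2 := by gcongr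
    have h4 : b * ‖y‖ ^ 2 ≤ b * s ^ 2 := by gcongr
    have h5 : ‖c‖ ^ 2 ≤ s ^ 2 - 2 * s * δ := by
      have : a * s ^ 2 + b * s ^ 2 = s ^ 2 := by rw [← add_mul, hab, one_mul]
      linarith
    have h6 : δ ≤ s := by nlinarith [sq_nonneg ‖c‖]
    exact abs_le_of_sq_le_sq' (by nlinarith) (sub_nonneg.2 h6) |>.2
  have hcb : closedBall c δ ⊆ ball 0 r := by
    refine closedBall_subset_ball' ?_
    rw [dist_zero_right]
    linarith
  have htaylor : ∀ z ∈ ball (0 : ℂ) r,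
      ‖h z - h c - deriv h c * (z - c)‖ ≤ L / 2 * ‖z - c‖ ^ 2 := fun z hz =>
    norm_sub_sub_le_of_norm_deriv_sub_le (convex_ball 0 ρ) (fun z hz => H.differentiableAt hz)
      (hsub hcmem) (hsub hz) fun z hz => H.norm_deriv_sub_le (hsub hcmem) hz
  have hder : ∀ z ∈ closedBall c δ, L * s < ‖deriv h z‖ := fun z hz => by
    calc L * s ≤ L * ρ := by gcongr; linarith
      _ < _ := H.mul_exp_lt
      _ ≤ _ := H.exp_neg_le_norm_deriv (hsub (hcb hz))
  -- The first-order Taylor terms at c cancel in the convex combination. The remainders add up to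
  -- (L/2)(a b² + b a²)‖x - y‖² = L s δ, because a + b = 1. The covering lemma then applies with ν =
  -- L s.
  have hdist : ‖h c - (a • h x + b • h y)‖ ≤ L * s * δ := by
    have h1 := htaylor x hx
    have h2 := htaylor y hy
    rw [hxc, norm_smul, Real.norm_of_nonneg hb] at h1
    rw [hyc, norm_neg, norm_smul, Real.norm_of_nonneg ha] at h2
    calc ‖h c - (a • h x + b • h y)‖
        = ‖a • (h x - h c - deriv h c * b • (x - y)) +
            b • (h y - h c - deriv h c * -(a • (x - y)))‖ := by
          rw [norm_sub_rev]
          congr 1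
          rw [eq_sub_of_add_eq hab]; simp only [Complex.real_smul]; push_cast; ring
      _ ≤ a * (L / 2 * (b * ‖x - y‖) ^ 2) + b * (L / 2 * (a * ‖x - y‖) ^ 2) := by
          refine (norm_add_le _ _).trans ?_
          rw [norm_smul, norm_smul, Real.norm_of_nonneg ha, Real.norm_of_nonneg hb]
          gcongr
      _ = L * s * δ := by
          rw [hδ, eq_sub_of_add_eq hab]
          field_simp
          ring
  obtain ⟨z, hz, hzw⟩ := exists_mem_closedBall_eq_of_lt_norm_deriv hδ0 (by positivity)
    (fun z hz => H.differentiableAt (hsub (hcb hz))) hder hdist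
  exact ⟨z, hcb hz, hzw⟩

end HasSmallPreSchwarzian


/-! ### Schwarz–Pick and the pre-Schwarzian of lemniscate starlike functions -/

theorem one_add_conj_mul_ne_zero {a w : ℂ} (ha : ‖a‖ < 1) (hw : ‖w‖ < 1) :
    1 + conj a * w ≠ 0 := by
  intro h
  have h1 : ‖conj a * w‖ = 1 := by
    rw [← norm_neg, ← eq_neg_of_add_eq_zero_left h, norm_one]
  rw [norm_mul, Complex.norm_conj] at h1
  nlinarith [norm_nonneg a, norm_nonneg w]

theorem mapsTo_mobius {a : ℂ} (ha : ‖a‖ < 1) :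
    MapsTo (fun w => (w + a) / (1 + conj a * w)) (ball 0 1) (ball 0 1) := by
  intro w hw
  rw [mem_ball_zero_iff] at hw ⊢
  have h0 := one_add_conj_mul_ne_zero ha hw
  rw [norm_div, div_lt_one (norm_pos_iff.2 h0)]
  refine lt_of_pow_lt_pow_left₀ 2 (norm_nonneg _) ?_
  have h1 : ‖1 + conj a * w‖ ^ 2 - ‖w + a‖ ^ 2 = (1 - ‖a‖ ^ 2) * (1 - ‖w‖ ^ 2) := by
    simp only [Complex.sq_norm, Complex.normSq_apply, Complex.add_re, Complex.add_im,
      Complex.mul_re, Complex.mul_im, Complex.conj_re, Complex.conj_im, Complex.one_re,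
      Complex.one_im]
    ring
  have h2 : 0 < (1 - ‖a‖ ^ 2) * (1 - ‖w‖ ^ 2) := by
    apply mul_pos <;> nlinarith [norm_nonneg a, norm_nonneg w]
  linarith

theorem hasDerivAt_mobius {a w : ℂ} (ha : ‖a‖ < 1) (hw : ‖w‖ < 1) :
    HasDerivAt (fun w => (w + a) / (1 + conj a * w))
      ((1 - conj a * a) / (1 + conj a * w) ^ 2) w := by
  have h0 := one_add_conj_mul_ne_zero ha hw
  have h1 : HasDerivAt (fun w : ℂ => 1 + conj a * w) (conj a) w := by
    simpa using ((hasDerivAt_id w).const_mul (conj a)).const_add 1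
  have := ((hasDerivAt_id w).add_const a).fun_div h1 h0
  convert! this using 1
  simp only [id]
  ring

/-- The Schwarz–Pick inequality for the derivative. -/
theorem norm_deriv_mul_le_of_mem_classBs {ω : ℂ → ℂ} (hω : ω ∈ ClassBs) {z : ℂ} (hz : ‖z‖ < 1) :
    ‖deriv ω z‖ * (1 - ‖z‖ ^ 2) ≤ 1 - ‖ω z‖ ^ 2 := by
  obtain ⟨hd, hm⟩ := hω
  have hb : ‖-ω z‖ < 1 := by
    rw [norm_neg]; exact mem_ball_zero_iff.1 (hm (mem_ball_zero_iff.2 hz))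
  have hb' : ‖ω z‖ < 1 := by rwa [norm_neg] at hb
  -- Disk automorphisms before and after ω move z and ω z to the origin, where the Schwarz lemma
  -- applies.
  set F := (fun w => (w + -ω z) / (1 + conj (-ω z) * w)) ∘ ω ∘
    fun w => (w + z) / (1 + conj z * w) with hF
  have hmob : ∀ {a : ℂ}, ‖a‖ < 1 →
      DifferentiableOn ℂ (fun w => (w + a) / (1 + conj a * w)) (ball 0 1) := fun ha w hw =>
    (hasDerivAt_mobius ha (mem_ball_zero_iff.1 hw)).differentiableAt.differentiableWithinAt
  have hFd : DifferentiableOn ℂ F (ball 0 1) :=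
    (hmob hb).comp (hd.comp (hmob hz) (mapsTo_mobius hz)) (hm.comp (mapsTo_mobius hz))
  have hFm : MapsTo F (ball 0 1) (ball 0 1) :=
    (mapsTo_mobius hb).comp (hm.comp (mapsTo_mobius hz))
  have hF0 : F 0 = 0 := by simp [hF]
  have h1 := Complex.norm_deriv_le_one_of_mapsTo_ball hFd
    (by rw [hF0]; exact hFm.mono_right ball_subset_closedBall) one_pos
  have h2 := hasDerivAt_mobius hz (w := 0) (by simp)
  have hωz : HasDerivAt ω (deriv ω z) ((0 + z) / (1 + conj z * 0)) := by
    simpa using (hd.differentiableAt (isOpen_ball.mem_nhds (mem_ball_zero_iff.2 hz))).hasDerivAt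
  have h3 : HasDerivAt (fun w => (w + -ω z) / (1 + conj (-ω z) * w))
      ((1 - conj (-ω z) * -ω z) / (1 + conj (-ω z) * ω z) ^ 2)
      (ω ((0 + z) / (1 + conj z * 0))) := by
    simpa using hasDerivAt_mobius hb hb'
  have h4 := (h3.comp (0 : ℂ) (hωz.comp (0 : ℂ) h2)).deriv
  rw [← hF] at h4
  have e1 : ∀ a : ℂ, 1 + conj (-a) * a = ((1 - ‖a‖ ^ 2 : ℝ) : ℂ) := fun a => by
    push_cast
    rw [← Complex.conj_mul']
    simp only [map_neg]
    ring
  have e2 : 1 - conj (-ω z) * -ω z = ((1 - ‖ω z‖ ^ 2 : ℝ) : ℂ) := by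
    rw [← e1]; simp only [map_neg]; ring
  have e3 : (1 - conj z * z) / (1 + conj z * 0) ^ 2 = ((1 - ‖z‖ ^ 2 : ℝ) : ℂ) := by
    rw [← e1]; simp only [map_neg]; ring
  have p1 : 0 < 1 - ‖ω z‖ ^ 2 := by nlinarith [norm_nonneg (ω z)]
  have p2 : 0 < 1 - ‖z‖ ^ 2 := by nlinarith [norm_nonneg z]
  rw [h4, e1, e2, e3, norm_mul, norm_mul, norm_div, norm_pow, Complex.norm_real, Complex.norm_real,
    Real.norm_of_nonneg p1.le, Real.norm_of_nonneg p2.le, sq (1 - ‖ω z‖ ^ 2), ← div_div,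
    div_self p1.ne', one_div, inv_mul_le_iff₀ p1, mul_one] at h1
  exact h1

theorem sq_cpow_half (u : ℂ) : (u ^ (1 / 2 : ℂ)) ^ 2 = u := by
  rw [one_div]
  exact Complex.cpow_ofNat_inv_pow u 2

theorem re_cpow_half_nonneg (u : ℂ) : 0 ≤ (u ^ (1 / 2 : ℂ)).re := by
  by_cases h : u = 0
  · simp [h]
  rw [Complex.cpow_def_of_ne_zero h, Complex.exp_re]
  refine mul_nonneg (Real.exp_pos _).le (Real.cos_nonneg_of_mem_Icc ?_)
  have e : (Complex.log u * (1 / 2)).im = u.arg / 2 := by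
    have : (1 / 2 : ℂ) = ((1 / 2 : ℝ) : ℂ) := by push_cast; rfl
    rw [this, Complex.im_mul_ofReal, Complex.log_im]
    ring
  rw [e]
  have h1 := Complex.neg_pi_lt_arg u
  have h2 := Complex.arg_le_pi u
  constructor <;> linarith

/-- The pre-Schwarzian bound away from the origin. -/
theorem norm_deriv_deriv_le_of_ne_zero {h : ℂ → ℂ} (hh : h ∈ ClassSLStar) {z : ℂ}
    (hz : ‖z‖ < 0.312) (hz0 : z ≠ 0) : ‖deriv (deriv h) z‖ ≤ 1.3 * ‖deriv h z‖ := by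
  obtain ⟨⟨hd, h00, -⟩, ω, hω, hω0, hsub⟩ := hh
  have hz1 : ‖z‖ < 1 := by linarith
  have hzm : z ∈ ball (0 : ℂ) 1 := mem_ball_zero_iff.2 hz1
  have hnhds : ball (0 : ℂ) 1 ∈ 𝓝 z := isOpen_ball.mem_nhds hzm
  have hωz : ‖ω z‖ ≤ ‖z‖ :=
    Complex.norm_le_norm_of_mapsTo_ball hω.1 (hω.2.mono_right ball_subset_closedBall) hω0 hz1
  have hωd : HasDerivAt ω (deriv ω z) z := (hω.1.differentiableAt hnhds).hasDerivAt
  have hre : ∀ w : ℂ, ‖w‖ < 1 → 1 - ‖w‖ ≤ (1 + w).re := fun w _ => by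
    have := neg_le_of_abs_le (Complex.abs_re_le_norm w)
    rw [Complex.add_re, Complex.one_re]
    linarith
  have hslit : 1 + ω z ∈ Complex.slitPlane := by
    have := hre (ω z) (by linarith)
    exact Or.inl (by linarith)
  have hne : 1 + ω z ≠ 0 := Complex.slitPlane_ne_zero hslit
  set p : ℂ → ℂ := fun w => (1 + ω w) ^ (1 / 2 : ℂ) with hp
  have hpsq : ∀ w, p w ^ 2 = 1 + ω w := fun w => sq_cpow_half _
  have hp0 : p z ≠ 0 := fun h0 => hne (by rw [← hpsq, h0]; simp)
  have hpd : HasDerivAt p (deriv p z) z :=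
    ((hωd.const_add 1).differentiableAt.cpow (differentiableAt_const _) hslit).hasDerivAt
  have hp' : 2 * p z * deriv p z = deriv ω z := by
    have h1 := hpd.fun_pow 2
    have h2 : (fun w => p w ^ 2) = fun w => 1 + ω w := funext hpsq
    rw [h2] at h1
    have := h1.unique (hωd.const_add 1)
    simpa using this
  have hmul : ∀ w ∈ ball (0 : ℂ) 1, w * deriv h w = p w * h w := fun w hw => by
    by_cases hw0 : w = 0
    · simp [hw0, h00]
    have h1 := hsub w hw
    rw [starlikeQuotient, Function.update_of_ne hw0] at h1
    -- With x / 0 = 0, a zero of h away from the origin would make the quotient vanish and force ω w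
    -- = -1, outside the disk.
    by_cases hhw : h w = 0
    · exfalso
      rw [hhw, div_zero] at h1
      have h2 : (1 + ω w) = 0 := by
        rw [← hpsq w, hp]
        dsimp only at h1 ⊢
        rw [← h1, sq, zero_mul]
      have h3 := mem_ball_zero_iff.1 (hω.2 hw)
      have := hre _ h3
      rw [h2, Complex.zero_re] at this
      linarith
    · rw [div_eq_iff hhw] at h1
      exact h1
  have hdd : HasDerivAt (deriv h) (deriv (deriv h) z) z :=
    ((hd.deriv isOpen_ball).differentiableAt hnhds).hasDerivAt
  have hderiv : deriv h z + z * deriv (deriv h) z = deriv p z * h z + p z * deriv h z := by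
    have h1 := (hasDerivAt_id z).fun_mul hdd
    have h2 := hpd.fun_mul (hd.differentiableAt hnhds).hasDerivAt
    have h3 : (fun w => id w * deriv h w) =ᶠ[𝓝 z] fun w => p w * h w :=
      Filter.eventually_of_mem hnhds hmul
    have := h1.unique (h2.congr_of_eventuallyEq h3)
    simpa using this
  -- Logarithmic derivative of z h' = p h: h''/h' = p'/p + (p - 1)/z, where p² = 1 + ω gives p'/p =
  -- ω'/(2(1 + ω)).
  have key : deriv (deriv h) z =
      (deriv ω z / (2 * (1 + ω z)) + (p z - 1) / z) * deriv h z := by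
    have h1 := hmul z hzm
    rw [← hp', ← hpsq]
    field_simp
    linear_combination p z * hderiv - deriv p z * h1
  rw [key, norm_mul]
  refine mul_le_mul_of_nonneg_right ((norm_add_le _ _).trans ?_) (norm_nonneg _)
  have hone : 1 - ‖ω z‖ ≤ ‖1 + ω z‖ := (hre _ (by linarith)).trans (Complex.re_le_norm _)
  -- Schwarz–Pick with 1 - |ω|² ≤ |1 + ω|(1 + |z|) bounds this term by 1/(2(1 - |z|)), and 1/(2 ·
  -- 0.688) < 0.727.
  have b1 : ‖deriv ω z / (2 * (1 + ω z))‖ ≤ 0.727 := by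
    have hsp := norm_deriv_mul_le_of_mem_classBs hω hz1
    have hpos : 0 < ‖1 + ω z‖ := norm_pos_iff.2 hne
    rw [norm_div, norm_mul, Complex.norm_ofNat, div_le_iff₀ (by positivity)]
    have h1 : (‖deriv ω z‖ * (1 - ‖z‖)) * (1 + ‖z‖) ≤ ‖1 + ω z‖ * (1 + ‖z‖) := by
      have : 1 - ‖ω z‖ ^ 2 ≤ ‖1 + ω z‖ * (1 + ‖z‖) := by
        nlinarith [norm_nonneg (ω z)]
      linarith
    have h2 := le_of_mul_le_mul_right h1 (by positivity)
    nlinarith [norm_nonneg (deriv ω z)]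
  -- Here |p - 1| = |ω|/|p + 1| with |ω| ≤ |z|. As (Re p)² ≥ 1 - |z| > 0.688, Re p ≥ 0.82, and
  -- 1/1.82 < 0.55.
  have b2 : ‖(p z - 1) / z‖ ≤ 0.55 := by
    rw [norm_div, div_le_iff₀ (norm_pos_iff.2 hz0)]
    have h1 : ‖p z - 1‖ * ‖p z + 1‖ = ‖ω z‖ := by
      rw [← norm_mul]
      congr 1
      linear_combination hpsq z
    have hre0 : 0 ≤ (p z).re := re_cpow_half_nonneg _
    have h2 : (1 + ω z).re ≤ (p z).re ^ 2 := by
      rw [← hpsq, sq, Complex.mul_re]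
      nlinarith [sq_nonneg (p z).im]
    have h3 := hre (ω z) (by linarith)
    have h4 : 0.82 ≤ (p z).re := by nlinarith
    have h5 : 1.82 ≤ ‖p z + 1‖ := by
      refine le_trans ?_ (Complex.re_le_norm _)
      rw [Complex.add_re, Complex.one_re]
      linarith
    nlinarith [norm_nonneg (p z - 1)]
  linarith

theorem hasSmallPreSchwarzian_of_mem_classSLStar {h : ℂ → ℂ} (hh : h ∈ ClassSLStar) :
    HasSmallPreSchwarzian h 0.312 1.3 where
  differentiableOn := hh.1.1.mono (ball_subset_ball (by norm_num))
  deriv_zero := hh.1.2.2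
  radius_pos := by norm_num
  norm_le z hz := by
    by_cases hz0 : z = 0
    -- The formula for h''/h' divides by z, so the bound at the origin is obtained as a limit.
    · subst hz0
      have hb : ball (0 : ℂ) 1 ∈ 𝓝 (0 : ℂ) := ball_mem_nhds _ one_pos
      have h1 := hh.1.1.deriv isOpen_ball
      have c1 := (h1.differentiableAt hb).continuousAt
      have c2 := ((h1.deriv isOpen_ball).differentiableAt hb).continuousAt
      refine le_of_tendsto_of_tendsto (b := 𝓝[≠] 0) (c2.norm.mono_left nhdsWithin_le_nhds)
        ((c1.norm.const_mul 1.3).mono_left nhdsWithin_le_nhds) ?_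
      filter_upwards [self_mem_nhdsWithin,
        nhdsWithin_le_nhds (ball_mem_nhds (0 : ℂ) (by norm_num : (0 : ℝ) < 0.312))] with w hw0 hw
      exact norm_deriv_deriv_le_of_ne_zero hh (mem_ball_zero_iff.1 hw) hw0
    · exact norm_deriv_deriv_le_of_ne_zero hh (mem_ball_zero_iff.1 hz) hz0
  small := by
    -- The exponent 0.8112 is split into 8 equal parts, since 1 - x ≤ e^(-x) is sharp enough only
    -- for small x: e^0.1014 ≤ 1/0.8986 < 1.113.
    have h1 : Real.exp (2 * (1.3 * 0.312)) = Real.exp 0.1014 ^ 8 := by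
      rw [← Real.exp_nat_mul]; norm_num
    have h2 : Real.exp 0.1014 ≤ 1.113 := by
      have := Real.add_one_le_exp (-0.1014)
      rw [Real.exp_neg] at this
      have h3 := Real.exp_pos 0.1014
      rw [← one_div, le_div_iff₀ h3] at this
      linarith
    rw [h1]
    calc _ ≤ (1.3 : ℝ) * 0.312 * 1.113 ^ 8 := by gcongr
      _ < 1 := by norm_num


/-! ### The harmonic mapping in the coordinate h -/

namespace HasSmallPreSchwarzian

variable {h : ℂ → ℂ} {ρ M : ℝ}

theorem deriv_ne_zero (H : HasSmallPreSchwarzian h ρ M) {z : ℂ} (hz : z ∈ ball (0 : ℂ) ρ) :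
    deriv h z ≠ 0 :=
  norm_pos_iff.1 ((Real.exp_pos _).trans_le (H.exp_neg_le_norm_deriv hz))

theorem isOpen_image (H : HasSmallPreSchwarzian h ρ M) {r : ℝ} (hr : r ≤ ρ) :
    IsOpen (h '' ball 0 r) := by
  rw [isOpen_iff_mem_nhds]
  rintro _ ⟨z, hz, rfl⟩
  have hzρ := ball_subset_ball hr hz
  have hs : HasStrictDerivAt h (deriv h z) z :=
    (H.differentiableOn.analyticAt (isOpen_ball.mem_nhds hzρ)).hasStrictDerivAt
  rw [← hs.map_nhds_eq (H.deriv_ne_zero hzρ)]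
  exact Filter.image_mem_map (isOpen_ball.mem_nhds hz)

/-- The margin between r and ρ makes the contraction available on the closure of the convex image,
as the projection argument requires. -/
theorem closure_image_subset (H : HasSmallPreSchwarzian h ρ M) {r : ℝ} (hr : r < ρ) :
    closure (h '' ball 0 r) ⊆ h '' ball 0 ρ := by
  have hsub : closedBall (0 : ℂ) r ⊆ ball 0 ρ := closedBall_subset_ball hr
  have hcl : IsClosed (h '' closedBall 0 r) :=
    ((isCompact_closedBall 0 r).image_of_continuousOn
      (H.differentiableOn.continuousOn.mono hsub)).isClosed
  exact (closure_minimal (image_mono ball_subset_closedBall) hcl).trans (image_mono hsub)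

/-- The inverse of `h` on its image. -/
theorem exists_inverse (H : HasSmallPreSchwarzian h ρ M) :
    ∃ ψ : ℂ → ℂ, (∀ z ∈ ball (0 : ℂ) ρ, ψ (h z) = z) ∧
      ∀ z ∈ ball (0 : ℂ) ρ, HasDerivAt ψ (deriv h z)⁻¹ (h z) := by
  obtain ⟨c, hc, hle⟩ := H.exists_antilipschitz
  have hinv : ∀ z ∈ ball (0 : ℂ) ρ, Function.invFunOn h (ball 0 ρ) (h z) = z := fun z hz =>
    H.injOn.leftInvOn_invFunOn hz
  refine ⟨Function.invFunOn h (ball 0 ρ), hinv, fun z hz => ?_⟩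
  have hmem : h '' ball 0 ρ ∈ 𝓝 (h z) :=
    (H.isOpen_image le_rfl).mem_nhds (mem_image_of_mem h hz)
  have hlip : LipschitzOnWith (Real.toNNReal c⁻¹) (Function.invFunOn h (ball 0 ρ))
      (h '' ball 0 ρ) := by
    refine LipschitzOnWith.of_dist_le_mul ?_
    rintro _ ⟨x, hx, rfl⟩ _ ⟨y, hy, rfl⟩
    rw [hinv x hx, hinv y hy, Real.coe_toNNReal _ (inv_nonneg.2 hc.le), inv_mul_eq_div,
      le_div_iff₀' hc, dist_eq_norm, dist_eq_norm]
    exact hle x hx y hy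
  refine HasDerivAt.of_local_left_inverse (hlip.continuousOn.continuousAt hmem)
    (by rw [hinv z hz]; exact (H.differentiableAt hz).hasDerivAt) (H.deriv_ne_zero hz) ?_
  filter_upwards [hmem]
  rintro _ ⟨x, hx, rfl⟩
  rw [hinv x hx]

/-- The co-analytic part, expressed in the coordinate `h`, is a contraction. -/
theorem exists_lipschitzOnWith (H : HasSmallPreSchwarzian h ρ M) {g φ : ℂ → ℂ} {k : ℝ≥0}
    (hg : DifferentiableOn ℂ g (ball 0 ρ)) (hgφ : ∀ z ∈ ball (0 : ℂ) ρ, deriv g z = φ z * deriv h z)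
    (hφ : ∀ z ∈ ball (0 : ℂ) ρ, ‖φ z‖₊ ≤ k) :
    ∃ E : ℂ → ℂ, LipschitzOnWith k E (h '' ball 0 ρ) ∧
      ∀ z ∈ ball (0 : ℂ) ρ, E (h z) = conj (g z) := by
  obtain ⟨ψ, hψ, hψ'⟩ := H.exists_inverse
  refine ⟨fun w => conj (g (ψ w)), ?_, fun z hz => by simp only [hψ z hz]⟩
  have hlip : LipschitzOnWith k (g ∘ ψ) (h '' ball 0 ρ) := by
    refine (H.convex_image le_rfl).lipschitzOnWith_of_nnnorm_hasDerivWithin_le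
      (f' := fun w => φ (ψ w)) ?_ ?_
    · rintro _ ⟨z, hz, rfl⟩
      have h1 : HasDerivAt g (deriv g z) (ψ (h z)) := by
        rw [hψ z hz]
        exact (hg.differentiableAt (isOpen_ball.mem_nhds hz)).hasDerivAt
      have h2 := h1.comp (h z) (hψ' z hz)
      -- The chain rule gives (g ∘ h⁻¹)' = g'/h' = φ, so the Lipschitz constant is a bound for |φ|;
      -- conjugation is an isometry.
      rw [hgφ z hz, mul_inv_cancel_right₀ (H.deriv_ne_zero hz)] at h2
      rw [hψ z hz]
      exact h2.hasDerivWithinAt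
    · rintro _ ⟨z, hz, rfl⟩
      rw [hψ z hz]
      exact hφ z hz
  intro x hx y hy
  have := hlip hx hy
  rwa [← Complex.isometry_conj.edist_eq] at this

end HasSmallPreSchwarzian

theorem hasFDerivAt_add_conj {h g : ℂ → ℂ} {a b z : ℂ} (hh : HasDerivAt h a z)
    (hg : HasDerivAt g b z) :
    HasFDerivAt (fun z => h z + conj (g z))
      (a • (1 : ℂ →L[ℝ] ℂ) + (Complex.conjCLE : ℂ →L[ℝ] ℂ).comp (b • (1 : ℂ →L[ℝ] ℂ))) z := by
  exact hh.complexToReal_fderiv.add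
    ((Complex.conjCLE : ℂ →L[ℝ] ℂ).hasFDerivAt.comp z hg.complexToReal_fderiv)

theorem det_smul_add_conj (a b : ℂ) :
    (a • (1 : ℂ →L[ℝ] ℂ) + (Complex.conjCLE : ℂ →L[ℝ] ℂ).comp (b • (1 : ℂ →L[ℝ] ℂ))).det =
      ‖a‖ ^ 2 - ‖b‖ ^ 2 := by
  rw [ContinuousLinearMap.det, ← LinearMap.det_toMatrix Complex.basisOneI, Matrix.det_fin_two]
  simp only [LinearMap.toMatrix_apply, Complex.sq_norm, Complex.normSq_apply]
  simp
  ring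

theorem isCloseToConvexOn_add_conj {h g φ : ℂ → ℂ} {ρ M r : ℝ} (H : HasSmallPreSchwarzian h ρ M)
    (hρ : ρ < 1) (hr : 0 < r) (hrρ : r < ρ) (hφ : φ ∈ ClassBs)
    (hg : DifferentiableOn ℂ g (ball 0 1))
    (hgφ : ∀ z ∈ ball (0 : ℂ) 1, deriv g z = φ z * deriv h z) :
    IsCloseToConvexOn (fun z => h z + conj (g z)) (ball 0 r) := by
  have hρ1 : ball (0 : ℂ) ρ ⊆ ball 0 1 := ball_subset_ball hρ.le
  have hsub : ball (0 : ℂ) r ⊆ ball 0 ρ := ball_subset_ball hrρ.le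
  have hρc : closedBall (0 : ℂ) ρ ⊆ ball 0 1 := closedBall_subset_ball hρ
  -- Compactness of the closed disk of radius ρ < 1 turns |φ| < 1 into a uniform constant below 1.
  obtain ⟨m, hm, hmax⟩ := (isCompact_closedBall (0 : ℂ) ρ).exists_isMaxOn
    ⟨0, mem_closedBall_self H.radius_pos.le⟩ (hφ.1.continuousOn.mono hρc).nnnorm
  have hk : ‖φ m‖₊ < 1 := by
    have := mem_ball_zero_iff.1 (hφ.2 (hρc hm))
    exact_mod_cast this
  obtain ⟨E, hE, hEh⟩ := H.exists_lipschitzOnWith (k := ‖φ m‖₊) (hg.mono hρ1)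
    (fun z hz => hgφ z (hρ1 hz)) (fun z hz => isMaxOn_iff.1 hmax z (ball_subset_closedBall hz))
  have hgd : ∀ z ∈ ball (0 : ℂ) r, DifferentiableAt ℂ g z := fun z hz =>
    hg.differentiableAt (isOpen_ball.mem_nhds (hρ1 (hsub hz)))
  refine ⟨fun z hz => ?_, fun x hx y hy hxy => ?_, fun z hz => ?_, ?_⟩
  · have h1 : AnalyticAt ℂ h z := H.differentiableOn.analyticAt (isOpen_ball.mem_nhds (hsub hz))
    have h2 : AnalyticAt ℂ g z := hg.analyticAt (isOpen_ball.mem_nhds (hρ1 (hsub hz)))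
    exact h1.harmonicAt.add h2.harmonicAt_conj
  · refine H.injOn (hsub hx) (hsub hy) ?_
    have h1 := hE.dist_le_mul _ (mem_image_of_mem h (hsub hx)) _ (mem_image_of_mem h (hsub hy))
    rw [hEh x (hsub hx), hEh y (hsub hy)] at h1
    have h2 : dist (h x) (h y) = dist (conj (g x)) (conj (g y)) := by
      rw [dist_eq_norm, dist_eq_norm, ← norm_neg (conj (g x) - conj (g y))]
      congr 1
      linear_combination hxy
    have hk' : ((‖φ m‖₊ : ℝ≥0) : ℝ) < 1 := hk
    by_contra hne
    have := dist_pos.2 hne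
    nlinarith
  · have h1 := hasFDerivAt_add_conj (H.differentiableAt (hsub hz)).hasDerivAt
      (hgd z hz).hasDerivAt
    refine ⟨h1.differentiableAt, ?_⟩
    rw [h1.fderiv, det_smul_add_conj, hgφ z (hρ1 (hsub hz)), norm_mul]
    have h2 : 0 < ‖deriv h z‖ := norm_pos_iff.2 (H.deriv_ne_zero (hsub hz))
    have h3 : ‖φ z‖ < 1 := mem_ball_zero_iff.1 (hφ.2 (hρ1 (hsub hz)))
    have h4 : 0 < 1 - ‖φ z‖ ^ 2 := by nlinarith [norm_nonneg (φ z)]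
    have : 0 < ‖deriv h z‖ ^ 2 * (1 - ‖φ z‖ ^ 2) := by positivity
    linarith
  · have himg : (fun z => h z + conj (g z)) '' ball 0 r =
        (fun w => w + E w) '' (h '' ball 0 r) := by
      rw [image_image]
      exact image_congr fun z hz => by rw [hEh z (hsub hz)]
    rw [himg]
    exact isCloseToConvexDomain_image_id_add (H.isOpen_image hrρ.le) (H.convex_image hrρ.le)
      ((nonempty_ball.2 hr).image h) hk (hE.mono (H.closure_image_subset hrρ))

/-! ### The radius and the main theorem -/

/-- After removing the factor r - 1, the remaining cubic is strictly increasing, hence has a single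
real root, located by a sign change. -/
theorem exists_radius : ∃ r₀ : ℝ, r₀ ∈ Ioo (0.3119 : ℝ) 0.3120 ∧
    1 - 6 * r₀ + 12 * r₀ ^ 2 - 11 * r₀ ^ 3 + 4 * r₀ ^ 4 = 0 ∧
    ∀ r ∈ Ioo (0 : ℝ) 1, 1 - 6 * r + 12 * r ^ 2 - 11 * r ^ 3 + 4 * r ^ 4 = 0 → r = r₀ := by
  have hfac : ∀ r : ℝ, 1 - 6 * r + 12 * r ^ 2 - 11 * r ^ 3 + 4 * r ^ 4 =
      (r - 1) * (4 * r ^ 3 - 7 * r ^ 2 + 5 * r - 1) := fun r => by ring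
  have hcont : ContinuousOn (fun r : ℝ => 4 * r ^ 3 - 7 * r ^ 2 + 5 * r - 1)
      (Icc 0.3119 0.3120) := by fun_prop
  obtain ⟨r₀, hr₀, h0⟩ := intermediate_value_Ioo (by norm_num) hcont
    (show (0 : ℝ) ∈ Ioo _ _ by constructor <;> norm_num)
  dsimp only at h0
  refine ⟨r₀, hr₀, by rw [hfac, h0, mul_zero], fun r hr hroot => ?_⟩
  rw [hfac] at hroot
  have h1 := (mul_eq_zero.1 hroot).resolve_left (by linarith [hr.2])
  have h2 : (r - r₀) * (4 * (r ^ 2 + r * r₀ + r₀ ^ 2) - 7 * (r + r₀) + 5) = 0 := by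
    linear_combination h1 - h0
  have h3 : 0 < 4 * (r ^ 2 + r * r₀ + r₀ ^ 2) - 7 * (r + r₀) + 5 := by
    -- With u = r + r₀ the expression is 3u² - 7u + 5 + (r - r₀)². The quadratic in u has negative
    -- discriminant and its minimum at u = 7/6.
    nlinarith [sq_nonneg (r - r₀), sq_nonneg (r + r₀ - 7 / 6)]
  exact sub_eq_zero.1 ((mul_eq_zero.1 h2).resolve_right h3.ne')

end

theorem mainTheorem8 :
    ∃ r₀ : ℝ, r₀ ∈ Ioo (0 : ℝ) 1 ∧
      1 - 6 * r₀ + 12 * r₀ ^ 2 - 11 * r₀ ^ 3 + 4 * r₀ ^ 4 = 0 ∧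
      (∀ r ∈ Ioo (0 : ℝ) 1, 1 - 6 * r + 12 * r ^ 2 - 11 * r ^ 3 + 4 * r ^ 4 = 0 → r = r₀) ∧
      r₀ ∈ Ioo (0.3119 : ℝ) 0.3120 ∧
      ∀ h g φ : ℂ → ℂ, h ∈ ClassSLStar → φ ∈ ClassBs →
        DifferentiableOn ℂ g (ball 0 1) →
        (∀ z ∈ ball (0 : ℂ) 1, deriv g z = φ z * deriv h z) →
        IsUnivalentOn (fun z => h z + conj (g z)) (ball 0 r₀) ∧
          IsCloseToConvexOn (fun z => h z + conj (g z)) (ball 0 r₀) := by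
  obtain ⟨r₀, hr₀, hroot, huniq⟩ := exists_radius
  have hpos : 0 < r₀ := lt_trans (by norm_num) hr₀.1
  have hlt : r₀ < 0.312 := hr₀.2.trans_eq (by norm_num)
  refine ⟨r₀, ⟨hpos, hlt.trans (by norm_num)⟩, hroot, huniq, hr₀, fun h g φ hh hφ hg hgφ => ?_⟩
  have hctc := isCloseToConvexOn_add_conj (hasSmallPreSchwarzian_of_mem_classSLStar hh)
    (by norm_num) hpos hlt hφ hg hgφ
  exact ⟨hctc.2.1, hctc⟩
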